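/- **Lemma 5.12 (Separating Lemma).** Let $G=(V,E)$ be an infinite connected simple graph, regarded also as its 1-complex: every edge is a copy of $[0,1]$, and basic neighbourhoods of a vertex $v$ are the unions of half-open intervals $[v,i_e)$, one for each edge $e$ at $v$, with arbitrary inner edge points $i_e\in e$. Let $\beta G$ be the Stone–Čech compactification of this space, let closures be taken in $\beta G$, and let $G^*=\beta G\setminus G$. For a vertex $v$ let $O_{\beta G}(v)=\overline{E(v)}\setminus\overline{N(v)}$, where $E(v)$ is the union of the closed edges incident with $v$ and $N(v)$ is the set of neighbours of $v$; put $O_{\beta G}[V]=\bigcup_{v\in V}O_{\beta G}(v)$ and $G^\times=\beta G\setminus O_{\beta G}[V]$. Call a set $A\subseteq\beta G$ *tame* if it contains every connected component of $G^\times$ that it meets, and also every connected component $C$ of $G^*$ for which $A\cap C\cap O_{\beta G}[V]\neq\emptyset$. Let $A,B\subseteq\beta G$ be disjoint, closed and tame. Then there are a finite set $X\subseteq V$ and a partition of the set of components of $G-X$ into two disjoint (possibly empty) sets $\mathcal C_1,\mathcal C_2$ such that $$A\subseteq\overline{G[X\cup V[\mathcal C_1]]}\quad\text{and}\quad B\subseteq\overline{G[X\cup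 V[\mathcal C_2]]},$$ where $V[\mathcal C_i]$ is the union of the vertex sets of the components in $\mathcal C_i$, and induced subgraphs are regarded as subspaces of the 1-complex. -/

import Mathlib

noncomputable section

namespace GraphBeta

variable {V : Type*} (G : SimpleGraph V)

/-- The point set of the 1-complex of `G`, in barycentric coordinates: formal convex combinations
`(1 - t) v + t w` with `v = w` (a vertex) or `vw` an edge (a point of the topological edge). -/
def OneComplex : Type _ :=
  {p : V →₀ ℝ // ∃ v w : V, (v = w ∨ G.Adj v w) ∧
    ∃ t : unitInterval, p = Finsupp.single v (1 - (t : ℝ)) + Finsupp.single w (t : ℝ)}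

/-- A vertex of `G` as a point of the 1-complex. -/
def vertexPt (v : V) : OneComplex G :=
  ⟨Finsupp.single v 1, v, v, Or.inl rfl, 0, by simp⟩

/-- The parametrisation by `[0, 1]` of the topological edge `[x, y]`, where `d` is the edge `xy`
directed from `x` to `y`. -/
def edgePath (d : G.Dart) (t : unitInterval) : OneComplex G :=
  ⟨Finsupp.single d.fst (1 - (t : ℝ)) + Finsupp.single d.snd (t : ℝ),
    d.fst, d.snd, Or.inr d.adj, t, rfl⟩

/-- The topology of the 1-complex: a set is open iff its preimage in `[0, 1]` under every edge
parametrisation is open. In particular the unions of half-open intervals `[v, i_e)`, one for each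
edge `e` at `v` with `i_e` an arbitrary inner point of `e`, are a neighbourhood basis of `v`. -/
instance : TopologicalSpace (OneComplex G) :=
  ⨆ d : G.Dart, TopologicalSpace.coinduced (edgePath G d) inferInstance

/-- The induced subgraph `G[W]` as a subset of the 1-complex: the vertices in `W` and the points of
the edges with both ends in `W`. -/
def inducedPts (W : Set V) : Set (OneComplex G) :=
  {p | (p.1.support : Set V) ⊆ W}

/-- `E(v)` as a subset of the 1-complex: the union of all (closed) edges incident with `v`. -/
def incidentPts (v : V) : Set (OneComplex G) :=
  {p | ∃ d : G.Dart, d.fst = v ∧ p ∈ Set.range (edgePath G d)}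

/-- `N(v)` as a subset of the 1-complex: the set of neighbours of `v`. -/
def neighborPts (v : V) : Set (OneComplex G) :=
  vertexPt G '' G.neighborSet v

/-- The Stone–Čech compactification `βG` of the 1-complex of `G`. -/
abbrev Beta : Type _ := StoneCech (OneComplex G)

/-- The closure in `βG` of a subset of the 1-complex. -/
def betaClosure (S : Set (OneComplex G)) : Set (Beta G) :=
  closure (stoneCechUnit '' S)

/-- The Stone–Čech remainder `G^* = βG \ G`. -/
def remainder : Set (Beta G) :=
  (Set.range (stoneCechUnit : OneComplex G → Beta G))ᶜ

/-- The set `O_{βG}(v)`: the closure of `E(v)` minus the closure of `N(v)`, both taken in `βG`. -/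
def betaStar (v : V) : Set (Beta G) :=
  betaClosure G (incidentPts G v) \ betaClosure G (neighborPts G v)

/-- The set `O_{βG}[V]`, the union of the sets `O_{βG}(v)` over all vertices `v`. -/
def betaStars : Set (Beta G) :=
  ⋃ v : V, betaStar G v

/-- The auxiliary remainder `G^× = βG \ O_{βG}[V]`. -/
def auxRemainder : Set (Beta G) :=
  (betaStars G)ᶜ

/-- `A ⊆ βG` is tame: it contains every component of the subspace `G^×` that it meets, and every
component of the subspace `G^*` that it meets in a point of `O_{βG}[V]`. (For `x ∈ F`, the set
`connectedComponentIn F x` is the component of the subspace `F` containing `x`.) -/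
structure IsTame (A : Set (Beta G)) : Prop where
  aux_closed : ∀ x ∈ A, x ∈ auxRemainder G → connectedComponentIn (auxRemainder G) x ⊆ A
  component_subset : ∀ x ∈ A, x ∈ remainder G → x ∈ betaStars G →
    connectedComponentIn (remainder G) x ⊆ A

/-- `X ∪ V[𝒞]` for a set `𝒞` of components of `G - X`, where `V[𝒞]` is the union of the vertex sets
of the components in `𝒞`. -/
def sideVerts (X : Set V) (𝒞 : Set (G.ComponentCompl X)) : Set V :=
  X ∪ ⋃ C ∈ 𝒞, (C : Set V)

end GraphBeta

end

/-!
For a finite set `X` of vertices and a bipartition of the components of `G - X`, the two sides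
`G[X ∪ V[𝒞ᵢ]]` are closed, cover the 1-complex and overlap in the compact set `G[X]`. Hence their
closures in `βG` cover `βG` and are disjoint on `G^*`
(`betaClosure_sideVerts_inter_subset`, by `closure_stoneCechUnit_inter_subset`). The lemma is proved
on larger and larger parts of `βG`.

*On `G^×`.* The set `O_{βG}(v)` is the complement of the closure of `G - v` (`betaStar_eq_compl`), so
`G^×` is compact. Its space of components is profinite, so the traces of `A` and `B`, which are
unions of components of `G^×`, are separated by an open partition of `G^×`. By compactness this
partition extends to one of `G - X` for some finite `X`, and every component of `G - X`, being
connected, falls into one of the two parts (`exists_separation_auxRemainder`).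

*On `G^*`.* A component of `G^*` lies in the closure of exactly one of the two sides. If `A` meets it
in a point of `O_{βG}(v)`, then `A` contains it, and it also contains a point of `G^×`, whose side is
already known to be the right one (`IsTame.inter_remainder_subset`). That point comes from the
ultralimit of a family of segments of edges at `v` (`exists_isPreconnected_auxRemainder`).

*On `G`.* The part of `A` in the closure of the wrong side is now closed in `βG` and contained
in `G`, so it lies in a finite subgraph (`exists_finset_of_isClosed_subset_range`). Adding the vertices of this subgraph
to `X` repairs the inclusion for `A`, and likewise for `B`.

Neither normality of the 1-complex nor the fact that it embeds in `βG` is used. Gluing a Urysohn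
function of the compact space `βG` takes the place of the former, and affine extensions of arbitrary
functions on the vertices (`continuous_affineExt`) take the place of the latter.
-/

open Set Filter Topology

/-! ### Stone–Čech compactifications and separation by components -/

section StoneCech

variable {α : Type*} [TopologicalSpace α]

/-- If two closed sets cover `α`, the intersection of their closures in `βα` is the closure of
their intersection. No separation axiom on `α` is needed, because a function which vanishes on the
intersection can be replaced by `0` on one of the two sets. -/
theorem closure_stoneCechUnit_inter_subset {s t : Set α} (hs : IsClosed s) (ht : IsClosed t)
    (hst : s ∪ t = univ) :
    closure (stoneCechUnit '' s) ∩ closure (stoneCechUnit '' t) ⊆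
      closure (stoneCechUnit '' (s ∩ t) : Set (StoneCech α)) := by
  classical
  rintro z ⟨hzs, hzt⟩
  by_contra hz
  obtain ⟨φ, hφ0, hφ1, hφ⟩ := exists_continuous_zero_one_of_isClosed isClosed_closure
    (isClosed_singleton (x := z)) (Set.disjoint_singleton_right.2 hz)
  have hc : Continuous fun a : α => φ (stoneCechUnit a) :=
    φ.continuous.comp continuous_stoneCechUnit
  have h0 : ∀ a ∈ s ∩ t, φ (stoneCechUnit a) = 0 := fun a ha =>
    hφ0 (subset_closure (mem_image_of_mem _ ha))
  let g : α → ℝ := fun a => if a ∈ s then φ (stoneCechUnit a) else 0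
  have hgs : ∀ a ∈ s, g a = φ (stoneCechUnit a) := fun a ha => if_pos ha
  have hgt : ∀ a ∈ t, g a = 0 := fun a ha => by
    by_cases h : a ∈ s
    · rw [hgs a h, h0 a ⟨h, ha⟩]
    · exact if_neg h
  have hg : Continuous g := by
    rw [← continuousOn_univ, ← hst]
    refine ContinuousOn.union_of_isClosed ?_ ?_ hs ht
    · exact hc.continuousOn.congr hgs
    · exact continuousOn_const.congr hgt
  have hg' : Continuous fun a => (⟨g a, by
      by_cases h : a ∈ s
      · rw [hgs a h]; exact hφ _
      · have : g a = 0 := if_neg h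
        rw [this]; simp⟩ : unitInterval) := hg.subtype_mk _
  have hE := continuous_subtype_val.comp (continuous_stoneCechExtend hg')
  have e1 : EqOn (Subtype.val ∘ stoneCechExtend hg') φ (stoneCechUnit '' s) := by
    rintro _ ⟨a, ha, rfl⟩
    simp [stoneCechExtend_stoneCechUnit, hgs a ha]
  have e2 : EqOn (Subtype.val ∘ stoneCechExtend hg') (fun _ => (0 : ℝ)) (stoneCechUnit '' t) := by
    rintro _ ⟨a, ha, rfl⟩
    simp [stoneCechExtend_stoneCechUnit, hgt a ha]
  have h1 := e1.closure hE φ.continuous hzs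
  have h2 := e2.closure hE continuous_const hzt
  have h3 : φ z = 1 := hφ1 rfl
  rw [h1, h3] at h2
  exact one_ne_zero h2

/-- A continuous real function separates a point of `α` from the closure of a set in `βα`. -/
theorem stoneCechUnit_notMem_closure {f : α → ℝ} (hf : Continuous f) {a b : ℝ} (hab : a < b)
    {s : Set α} {x : α} (hx : f x ≤ a) (hs : ∀ y ∈ s, b ≤ f y) :
    stoneCechUnit x ∉ closure (stoneCechUnit '' s : Set (StoneCech α)) := by
  have hg : Continuous fun y => Set.projIcc a b hab.le (f y) := continuous_projIcc.comp hf
  intro h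
  have e : EqOn (stoneCechExtend hg) (fun _ => ⟨b, right_mem_Icc.2 hab.le⟩)
      (stoneCechUnit '' s) := by
    rintro _ ⟨y, hy, rfl⟩
    simpa [stoneCechExtend_stoneCechUnit] using Set.projIcc_of_right_le hab.le (hs y hy)
  have h1 := e.closure (continuous_stoneCechExtend hg) continuous_const h
  rw [stoneCechExtend_stoneCechUnit, Set.projIcc_of_le_left hab.le hx] at h1
  exact hab.ne (congrArg Subtype.val h1)

/-- A continuous real function is bounded above on every part of `α` which is closed in `βα`: its
extension to `βα` with values in `[0, ∞]` attains its maximum there. -/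
theorem exists_forall_le_of_isClosed_stoneCech {f : α → ℝ} (hf : Continuous f)
    {Z : Set (StoneCech α)} (hZ : IsClosed Z) (hZr : Z ⊆ range stoneCechUnit) :
    ∃ M : ℝ, ∀ x, stoneCechUnit x ∈ Z → f x ≤ M := by
  rcases Z.eq_empty_or_nonempty with rfl | hne
  · exact ⟨0, fun x hx => hx.elim⟩
  have hg : Continuous fun y => ENNReal.ofReal (f y) := ENNReal.continuous_ofReal.comp hf
  obtain ⟨z, hz, hmax⟩ := hZ.isCompact.exists_isMaxOn hne
    (continuous_stoneCechExtend hg).continuousOn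
  obtain ⟨y, rfl⟩ := hZr hz
  refine ⟨max (f y) 0, fun x hx => ?_⟩
  have h := hmax hx
  simp only [mem_ofPred_eq, stoneCechExtend_stoneCechUnit] at h
  rcases le_total (f x) 0 with h0 | h0
  · exact h0.trans (le_max_right _ _)
  · rcases (ENNReal.ofReal_le_ofReal_iff').1 h with h | h
    · exact h.trans (le_max_left _ _)
    · exact h.trans (le_max_right _ _)

end StoneCech

/-- In a compact Hausdorff space, two disjoint closed sets containing every component of a closed
subspace `T` which they meet are separated on `T` by an open partition: the space of components of
`T` is profinite. -/
theorem exists_isOpen_separation_of_components {X : Type*} [TopologicalSpace X] [CompactSpace X]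
    [T2Space X] {T A B : Set X} (hT : IsClosed T) (hA : IsClosed A) (hB : IsClosed B)
    (hAB : Disjoint A B) (hAT : ∀ x ∈ A, x ∈ T → connectedComponentIn T x ⊆ A) :
    ∃ U W : Set X, IsOpen U ∧ IsOpen W ∧ Disjoint U W ∧ T ⊆ U ∪ W ∧ A ∩ T ⊆ U ∧ B ∩ T ⊆ W := by
  have : CompactSpace T := isCompact_iff_compactSpace.1 hT.isCompact
  let π : T → ConnectedComponents T := ConnectedComponents.mk
  have hπ : Continuous π := ConnectedComponents.continuous_coe
  have himg : ∀ S : Set X, IsClosed S → IsClosed (π '' (Subtype.val ⁻¹' S)) := fun S hS =>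
    ((hS.preimage continuous_subtype_val).isCompact.image hπ).isClosed
  have hdisj : π '' (Subtype.val ⁻¹' A) ⊆ (π '' (Subtype.val ⁻¹' B))ᶜ := by
    rintro _ ⟨a, ha, rfl⟩ ⟨b, hb, hab⟩
    have h1 : b ∈ connectedComponent a := ConnectedComponents.coe_eq_coe'.1 hab
    have h2 : (b : X) ∈ connectedComponentIn T a := by
      rw [connectedComponentIn_eq_image a.2]
      exact ⟨b, h1, rfl⟩
    exact disjoint_left.1 hAB (hAT a ha a.2 h2) hb
  obtain ⟨C, hC, hAC, hCB⟩ := exists_clopen_of_closed_subset_open (himg A hA)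
    (himg B hB).isOpen_compl hdisj
  have hcl : ∀ S : Set (ConnectedComponents T), IsClosed S →
      IsClosed (Subtype.val '' (π ⁻¹' S) : Set X) := fun S hS =>
    ((hS.preimage hπ).isCompact.image continuous_subtype_val).isClosed
  have hd : Disjoint (Subtype.val '' (π ⁻¹' C) : Set X) (Subtype.val '' (π ⁻¹' Cᶜ)) := by
    rw [disjoint_image_iff Subtype.val_injective]
    exact disjoint_compl_right.preimage π
  obtain ⟨U, W, hU, hW, hCU, hCW, hUW⟩ :=
    normal_separation (hcl C hC.isClosed) (hcl _ hC.compl.isClosed) hd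
  refine ⟨U, W, hU, hW, hUW, fun x hx => ?_, fun x hx => ?_, fun x hx => ?_⟩
  · by_cases h : π ⟨x, hx⟩ ∈ C
    · exact Or.inl (hCU ⟨⟨x, hx⟩, h, rfl⟩)
    · exact Or.inr (hCW ⟨⟨x, hx⟩, h, rfl⟩)
  · exact hCU ⟨⟨x, hx.2⟩, hAC ⟨⟨x, hx.2⟩, hx.1, rfl⟩, rfl⟩
  · exact hCW ⟨⟨x, hx.2⟩, fun h => hCB h ⟨⟨x, hx.2⟩, hx.1, rfl⟩, rfl⟩

namespace GraphBeta

variable {V : Type*} {G : SimpleGraph V}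

/-! ### The topology of the 1-complex -/

theorem continuous_iff_edgePath {Y : Type*} [TopologicalSpace Y] {f : OneComplex G → Y} :
    Continuous f ↔ ∀ d : G.Dart, Continuous (f ∘ edgePath G d) := by
  simp only [continuous_iSup_dom, continuous_coinduced_dom]

theorem continuous_edgePath (d : G.Dart) : Continuous (edgePath G d) :=
  continuous_iff_edgePath.1 continuous_id d

theorem isClosed_iff_edgePath {s : Set (OneComplex G)} :
    IsClosed s ↔ ∀ d : G.Dart, IsClosed (edgePath G d ⁻¹' s) := by
  rw [isClosed_iSup_iff]
  simp only [isClosed_coinduced]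

theorem edgePath_zero (d : G.Dart) : edgePath G d 0 = vertexPt G d.fst :=
  Subtype.ext (by simp [edgePath, vertexPt])

theorem edgePath_one (d : G.Dart) : edgePath G d 1 = vertexPt G d.snd :=
  Subtype.ext (by simp [edgePath, vertexPt])

theorem edgePath_symm (d : G.Dart) (t : unitInterval) :
    edgePath G d.symm t = edgePath G d (unitInterval.symm t) :=
  Subtype.ext (by simp [edgePath, add_comm])

theorem edgePath_apply_fst (d : G.Dart) (t : unitInterval) :
    (edgePath G d t).1 d.fst = 1 - t := by
  simp [edgePath, d.adj.ne]

theorem edgePath_apply_snd (d : G.Dart) (t : unitInterval) :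
    (edgePath G d t).1 d.snd = t := by
  simp [edgePath]

theorem edgePath_apply_of_ne {d : G.Dart} {u : V} (h₁ : u ≠ d.fst) (h₂ : u ≠ d.snd)
    (t : unitInterval) : (edgePath G d t).1 u = 0 := by
  simp [edgePath, h₁.symm, h₂.symm]

theorem vertexPt_apply_of_ne {u v : V} (h : u ≠ v) : (vertexPt G v).1 u = 0 := by
  simp [vertexPt, h.symm]

theorem OneComplex.exists_apply_ne_zero (p : OneComplex G) : ∃ u, p.1 u ≠ 0 := by
  obtain ⟨_, v, w, h, t, rfl⟩ := p
  by_contra! h0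
  have hv := h0 v
  have hw := h0 w
  rcases h with rfl | h
  · simp at hv
  · simp [h.ne] at hv hw
    simp [hw] at hv

theorem OneComplex.apply_nonneg (p : OneComplex G) (u : V) : 0 ≤ p.1 u := by
  classical
  obtain ⟨_, v, w, -, t, rfl⟩ := p
  have h0 := t.2.1
  have h1 := sub_nonneg.2 t.2.2
  simp only [Finsupp.add_apply, Finsupp.single_apply]
  split_ifs <;> linarith

theorem exists_eq_edgePath (hG : ∀ v, ∃ w, G.Adj v w) (p : OneComplex G) :
    ∃ d t, p = edgePath G d t := by
  obtain ⟨_, v, w, h, t, rfl⟩ := p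
  rcases h with rfl | h
  · obtain ⟨w, hw⟩ := hG v
    exact ⟨⟨(v, w), hw⟩, 0, Subtype.ext (by simp [edgePath])⟩
  · exact ⟨⟨(v, w), h⟩, t, rfl⟩

theorem OneComplex.eq_or_adj (p : OneComplex G) {u v : V} (hu : p.1 u ≠ 0) (hv : p.1 v ≠ 0) :
    u = v ∨ G.Adj u v := by
  classical
  obtain ⟨_, a, b, h, t, rfl⟩ := p
  have key : ∀ u, (Finsupp.single a (1 - (t : ℝ)) + Finsupp.single b (t : ℝ)) u ≠ 0 →
      u = a ∨ u = b := by
    intro u hu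
    by_contra! hh
    exact hu (by simp [hh.1.symm, hh.2.symm])
  rcases key u hu with rfl | rfl <;> rcases key v hv with rfl | rfl
  · exact Or.inl rfl
  · exact h
  · exact h.imp Eq.symm SimpleGraph.Adj.symm
  · exact Or.inl rfl

/-- The extension to the 1-complex of a function `k` on the vertices, affine on each edge. -/
noncomputable def affineExt (k : V → ℝ) (p : OneComplex G) : ℝ :=
  Finsupp.linearCombination ℝ k p.1

theorem affineExt_edgePath (k : V → ℝ) (d : G.Dart) (t : unitInterval) :
    affineExt k (edgePath G d t) = (1 - t) * k d.fst + t * k d.snd := by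
  simp only [affineExt, edgePath, map_add, Finsupp.linearCombination_single, smul_eq_mul]

/-- Continuity holds for an arbitrary function on the vertices, however unbounded, because the
topology of the 1-complex is coherent with its edges. -/
theorem continuous_affineExt (k : V → ℝ) : Continuous (affineExt k : OneComplex G → ℝ) := by
  rw [continuous_iff_edgePath]
  intro d
  have : affineExt k ∘ edgePath G d =
      fun t : unitInterval => (1 - (t : ℝ)) * k d.fst + t * k d.snd :=
    funext fun t => affineExt_edgePath k d t
  rw [this]
  fun_prop

theorem le_affineExt {k : V → ℝ} (hk : ∀ u, 0 ≤ k u) (p : OneComplex G) (u : V) :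
    p.1 u * k u ≤ affineExt k p := by
  classical
  rw [affineExt, Finsupp.linearCombination_apply, Finsupp.sum]
  by_cases h : u ∈ p.1.support
  · exact Finset.single_le_sum (f := fun i => p.1 i • k i)
      (fun i _ => mul_nonneg (p.apply_nonneg i) (hk i)) h
  · rw [Finsupp.notMem_support_iff.1 h, zero_mul]
    exact Finset.sum_nonneg fun i _ => mul_nonneg (p.apply_nonneg i) (hk i)

theorem continuous_apply (u : V) : Continuous fun p : OneComplex G => p.1 u := by
  classical
  have : (fun p : OneComplex G => p.1 u) = affineExt (Pi.single u 1) := by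
    funext p
    rw [affineExt, Finsupp.linearCombination_apply, Finsupp.sum]
    simp [Pi.single_apply]
  rw [this]
  exact continuous_affineExt _

theorem mem_inducedPts_iff {W : Set V} {p : OneComplex G} :
    p ∈ inducedPts G W ↔ ∀ u ∉ W, p.1 u = 0 := by
  simp only [inducedPts, mem_ofPred_eq, subset_def, Finset.mem_coe, Finsupp.mem_support_iff]
  exact forall_congr' fun u => not_imp_comm

theorem inducedPts_mono {W W' : Set V} (h : W ⊆ W') : inducedPts G W ⊆ inducedPts G W' :=
  fun _ hp => Subset.trans hp h

theorem inducedPts_inter (W W' : Set V) :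
    inducedPts G W ∩ inducedPts G W' = inducedPts G (W ∩ W') :=
  Set.ext fun _ => subset_inter_iff.symm

theorem isClosed_inducedPts (W : Set V) : IsClosed (inducedPts G W) := by
  have : inducedPts G W = ⋂ u ∈ Wᶜ, {p : OneComplex G | p.1 u = 0} := by
    ext p
    simp [mem_inducedPts_iff]
  rw [this]
  exact isClosed_biInter fun u _ => isClosed_eq (continuous_apply u) continuous_const

theorem vertexPt_mem_inducedPts {W : Set V} {v : V} (hv : v ∈ W) :
    vertexPt G v ∈ inducedPts G W :=
  mem_inducedPts_iff.2 fun _ hu => vertexPt_apply_of_ne fun h => hu (h ▸ hv)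

theorem edgePath_mem_inducedPts {W : Set V} {d : G.Dart} (h₁ : d.fst ∈ W) (h₂ : d.snd ∈ W)
    (t : unitInterval) : edgePath G d t ∈ inducedPts G W :=
  mem_inducedPts_iff.2 fun u hu =>
    edgePath_apply_of_ne (by rintro rfl; exact hu h₁) (by rintro rfl; exact hu h₂) t

theorem isCompact_inducedPts (X : Finset V) : IsCompact (inducedPts G (X : Set V)) := by
  classical
  let D : Set G.Dart := {d | d.fst ∈ X ∧ d.snd ∈ X}
  have hD : D.Finite := by
    refine Set.Finite.of_finite_image (f := SimpleGraph.Dart.toProd) ?_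
      (SimpleGraph.Dart.toProd_injective).injOn
    refine (X ×ˢ X).finite_toSet.subset ?_
    rintro _ ⟨d, hd, rfl⟩
    exact Finset.mem_coe.2 (Finset.mem_product.2 hd)
  have hK : IsCompact ((⋃ v ∈ X, {vertexPt G v}) ∪ ⋃ d ∈ D, range (edgePath G d)) :=
    (X.isCompact_biUnion fun v _ => isCompact_singleton).union
      (hD.isCompact_biUnion fun d _ => isCompact_range (continuous_edgePath d))
  refine hK.of_isClosed_subset (isClosed_inducedPts _) fun p hp => ?_
  obtain ⟨u, hu⟩ := p.exists_apply_ne_zero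
  have huX : u ∈ X := by
    by_contra h
    exact hu (mem_inducedPts_iff.1 hp u h)
  obtain ⟨q, v, w, h, t, rfl⟩ := p
  rcases h with rfl | h
  · left
    have hv : v = u := by
      by_contra hne
      exact hu (by simp [hne])
    subst hv
    exact mem_biUnion huX (Subtype.ext (by simp [vertexPt]))
  · -- An endpoint of the chosen edge may lie outside `X` if the point is the other endpoint.
    by_cases hv : v ∈ X
    · by_cases hw : w ∈ X
      · exact Or.inr (mem_biUnion (show (⟨(v, w), h⟩ : G.Dart) ∈ D from ⟨hv, hw⟩) ⟨t, rfl⟩)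
      · left
        have h0 := mem_inducedPts_iff.1 hp w hw
        simp [h.ne] at h0
        exact mem_biUnion hv (Subtype.ext (by simp [vertexPt, h0]))
    · left
      have h0 := mem_inducedPts_iff.1 hp v hv
      simp [h.ne'] at h0
      have ht : (t : ℝ) = 1 := by linarith
      have hwu : w = u := by
        by_contra hne
        exact hu (by simp [hne, ht])
      subst hwu
      exact mem_biUnion huX (Subtype.ext (by simp [vertexPt, ht]))

theorem mem_incidentPts_of_apply_ne_zero (hG : ∀ v, ∃ w, G.Adj v w) {v : V} {p : OneComplex G}
    (hp : p.1 v ≠ 0) : p ∈ incidentPts G v := by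
  obtain ⟨d, t, rfl⟩ := exists_eq_edgePath hG p
  by_cases h₁ : v = d.fst
  · exact ⟨d, h₁.symm, t, rfl⟩
  · by_cases h₂ : v = d.snd
    · exact ⟨d.symm, h₂.symm, unitInterval.symm t, by
        rw [edgePath_symm, unitInterval.symm_symm]⟩
    · exact (hp (edgePath_apply_of_ne h₁ h₂ t)).elim

theorem isClosed_incidentPts (v : V) :
    IsClosed (incidentPts G v) := by
  rw [isClosed_iff_edgePath]
  intro d
  by_cases h₁ : v = d.fst
  · have : edgePath G d ⁻¹' incidentPts G v = univ :=
      eq_univ_of_forall fun t => ⟨d, h₁.symm, t, rfl⟩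
    rw [this]
    exact isClosed_univ
  by_cases h₂ : v = d.snd
  · have : edgePath G d ⁻¹' incidentPts G v = univ :=
      eq_univ_of_forall fun t => ⟨d.symm, h₂.symm, unitInterval.symm t, by
        rw [edgePath_symm, unitInterval.symm_symm]⟩
    rw [this]
    exact isClosed_univ
  -- An edge which is not at `v` meets the star of `v` in at most its two endpoints.
  refine ((Set.toFinite {0, 1}).subset ?_).isClosed
  rintro t ⟨e, he, s, hs⟩
  by_contra! ht
  have ht' : t ≠ 0 ∧ t ≠ 1 := by simpa using ht
  have hf : (edgePath G d t).1 d.fst ≠ 0 := by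
    rw [edgePath_apply_fst]
    exact fun h => ht'.2 (Subtype.ext (sub_eq_zero.1 h).symm)
  have hsn : (edgePath G d t).1 d.snd ≠ 0 := by
    rw [edgePath_apply_snd]
    exact fun h => ht'.1 (Subtype.ext h)
  have key : ∀ u, (edgePath G d t).1 u ≠ 0 → u ≠ v → u = e.snd := fun u hu huv => by
    by_contra hne
    rw [← hs] at hu
    exact hu (edgePath_apply_of_ne (fun h => huv (h.trans he)) hne s)
  exact d.adj.ne ((key _ hf (Ne.symm h₁)).trans (key _ hsn (Ne.symm h₂)).symm)

theorem neighborPts_subset (v : V) : neighborPts G v ⊆ inducedPts G {v}ᶜ := by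
  rintro _ ⟨w, hw, rfl⟩
  exact vertexPt_mem_inducedPts (G.ne_of_adj hw).symm

theorem incidentPts_inter_subset (v : V) :
    incidentPts G v ∩ inducedPts G {v}ᶜ ⊆ neighborPts G v := by
  rintro _ ⟨⟨d, rfl, t, rfl⟩, h⟩
  have h0 := mem_inducedPts_iff.1 h d.fst (by simp)
  rw [edgePath_apply_fst] at h0
  have ht : t = 1 := Subtype.ext (sub_eq_zero.1 h0).symm
  exact ⟨d.snd, d.adj, by rw [ht, edgePath_one]⟩

/-! ### Open stars and the auxiliary remainder -/

theorem betaClosure_mono {s t : Set (OneComplex G)} (h : s ⊆ t) :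
    betaClosure G s ⊆ betaClosure G t :=
  closure_mono (image_mono h)

theorem isClosed_betaClosure (s : Set (OneComplex G)) : IsClosed (betaClosure G s) :=
  isClosed_closure

theorem betaClosure_union (s t : Set (OneComplex G)) :
    betaClosure G (s ∪ t) = betaClosure G s ∪ betaClosure G t := by
  rw [betaClosure, image_union, closure_union]
  rfl

theorem betaClosure_univ : betaClosure G univ = univ := by
  rw [betaClosure, image_univ]
  exact denseRange_stoneCechUnit.closure_range

theorem betaClosure_subset_range {s : Set (OneComplex G)} (hs : IsCompact s) :
    betaClosure G s ⊆ range stoneCechUnit := by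
  rw [betaClosure, (hs.image continuous_stoneCechUnit).isClosed.closure_eq]
  exact image_subset_range _ _

theorem stoneCechUnit_notMem_betaClosure {p : OneComplex G} {u : V} (hpu : p.1 u ≠ 0)
    {s : Set (OneComplex G)} (hs : ∀ q ∈ s, q.1 u = 0) :
    stoneCechUnit p ∉ betaClosure G s :=
  stoneCechUnit_notMem_closure (continuous_apply u).neg (a := -p.1 u) (b := 0)
    (neg_lt_zero.2 ((p.apply_nonneg u).lt_of_ne' hpu)) le_rfl
    fun q hq => le_of_eq (neg_eq_zero.2 (hs q hq)).symm

/-- `O_{βG}(v)` is the open set of all points of `βG` outside the closure of `G - v`. -/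
theorem betaStar_eq_compl (hG : ∀ v, ∃ w, G.Adj v w) (v : V) :
    betaStar G v = (betaClosure G (inducedPts G {v}ᶜ))ᶜ := by
  have hcover : incidentPts G v ∪ inducedPts G {v}ᶜ = univ := by
    refine eq_univ_of_forall fun p => ?_
    by_cases hp : p.1 v = 0
    · refine Or.inr (mem_inducedPts_iff.2 fun u hu => ?_)
      obtain rfl : u = v := by simpa using hu
      exact hp
    · exact Or.inl (mem_incidentPts_of_apply_ne_zero hG hp)
  ext z
  constructor
  · rintro ⟨h₁, h₂⟩ h₃
    exact h₂ (betaClosure_mono (incidentPts_inter_subset v)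
      (closure_stoneCechUnit_inter_subset (isClosed_incidentPts v) (isClosed_inducedPts _)
        hcover ⟨h₁, h₃⟩))
  · intro h
    refine ⟨?_, fun h' => h (betaClosure_mono (neighborPts_subset v) h')⟩
    have hz : z ∈ betaClosure G (incidentPts G v ∪ inducedPts G {v}ᶜ) := by
      rw [hcover, betaClosure_univ]
      trivial
    rw [betaClosure_union] at hz
    exact hz.resolve_right h

theorem mem_auxRemainder_iff (hG : ∀ v, ∃ w, G.Adj v w) {z : Beta G} :
    z ∈ auxRemainder G ↔ ∀ v, z ∈ betaClosure G (inducedPts G {v}ᶜ) := by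
  simp [auxRemainder, betaStars, betaStar_eq_compl hG]

theorem auxRemainder_eq_iInter (hG : ∀ v, ∃ w, G.Adj v w) :
    auxRemainder G = ⋂ v, betaClosure G (inducedPts G {v}ᶜ) :=
  Set.ext fun _ => (mem_auxRemainder_iff hG).trans mem_iInter.symm

theorem isClosed_auxRemainder (hG : ∀ v, ∃ w, G.Adj v w) : IsClosed (auxRemainder G) := by
  rw [auxRemainder_eq_iInter hG]
  exact isClosed_iInter fun _ => isClosed_betaClosure _

theorem auxRemainder_subset_remainder (hG : ∀ v, ∃ w, G.Adj v w) :
    auxRemainder G ⊆ remainder G := by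
  rintro _ hz ⟨p, rfl⟩
  obtain ⟨v, hv⟩ := p.exists_apply_ne_zero
  exact stoneCechUnit_notMem_betaClosure hv (fun q hq => mem_inducedPts_iff.1 hq v (by simp))
    ((mem_auxRemainder_iff hG).1 hz v)

/-- A point outside all open stars lies in the closure of `G - X` for every finite `X`: it is not
in the closure of the finitely many stars at `X` unless it is in the closure of their leaves
outside `X`. -/
theorem auxRemainder_subset_betaClosure (hG : ∀ v, ∃ w, G.Adj v w) (X : Finset V) :
    auxRemainder G ⊆ betaClosure G (inducedPts G (X : Set V)ᶜ) := by
  intro z hz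
  have hcover : inducedPts G (X : Set V)ᶜ ∪ ⋃ v ∈ X, incidentPts G v = univ := by
    refine eq_univ_of_forall fun p => ?_
    by_cases hp : p ∈ inducedPts G (X : Set V)ᶜ
    · exact Or.inl hp
    · rw [mem_inducedPts_iff] at hp
      push Not at hp
      obtain ⟨u, hu, hpu⟩ := hp
      exact Or.inr (mem_biUnion (by simpa using hu) (mem_incidentPts_of_apply_ne_zero hG hpu))
  have hmem : z ∈ betaClosure G (inducedPts G (X : Set V)ᶜ ∪ ⋃ v ∈ X, incidentPts G v) := by
    rw [hcover, betaClosure_univ]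
    trivial
  rw [betaClosure_union] at hmem
  rcases hmem with h | h
  · exact h
  rw [betaClosure, image_iUnion₂, Finset.closure_biUnion] at h
  obtain ⟨v, -, hv⟩ := mem_iUnion₂.1 h
  have hN : z ∈ betaClosure G (neighborPts G v) := by
    by_contra hN
    exact hz (mem_iUnion.2 ⟨v, hv, hN⟩)
  have hsub : neighborPts G v ⊆ inducedPts G (X : Set V)ᶜ ∪ inducedPts G (X : Set V) := by
    rintro _ ⟨w, -, rfl⟩
    by_cases hw : w ∈ X
    · exact Or.inr (vertexPt_mem_inducedPts hw)
    · exact Or.inl (vertexPt_mem_inducedPts hw)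
  have h' := betaClosure_mono hsub hN
  rw [betaClosure_union] at h'
  refine h'.resolve_right fun h'' => auxRemainder_subset_remainder hG hz ?_
  exact betaClosure_subset_range (isCompact_inducedPts X) h''

/-! ### Components of the remainder reach the auxiliary remainder -/

/-- Every point `x` of `G^* ∩ O_{βG}(v)` is joined inside `G^*` to a point of `G^×`. The point `x` is
a limit of points on edges at `v`, so it yields an ultrafilter on the neighbours of `v`. The
ultralimit of the segments of these edges from suitable inner points to the other endpoint is a
connected subset of `G^*` containing `x` and a limit of neighbours of `v`. -/
theorem exists_isPreconnected_auxRemainder (hG : ∀ v, ∃ w, G.Adj v w) {v : V} {x : Beta G}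
    (hxr : x ∈ remainder G) (hxv : x ∈ betaStar G v) :
    ∃ K ⊆ remainder G, IsPreconnected K ∧ x ∈ K ∧ ∃ y ∈ K, y ∈ auxRemainder G := by
  classical
  obtain ⟨O, O', hO, hO', hvO, hxO', hOO'⟩ :=
    t2_separation (show stoneCechUnit (vertexPt G v) ≠ x from fun h => hxr ⟨_, h⟩)
  -- On each edge at `v`, an initial segment lies in `O`, hence away from `x`.
  have hε : ∀ w, ∃ ε : ℝ, 0 < ε ∧ ε ≤ 1 ∧ ∀ (h : G.Adj v w) (s : unitInterval), (s : ℝ) < ε →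
      stoneCechUnit (edgePath G ⟨(v, w), h⟩ s) ∈ O := by
    intro w
    by_cases h : G.Adj v w
    · have ho : IsOpen ((fun s => stoneCechUnit (edgePath G ⟨(v, w), h⟩ s)) ⁻¹' O) :=
        hO.preimage (continuous_stoneCechUnit.comp (continuous_edgePath _))
      obtain ⟨ε, hε, hb⟩ := Metric.isOpen_iff.1 ho 0 (by
        rw [mem_preimage, edgePath_zero]
        exact hvO)
      refine ⟨min ε 1, lt_min hε one_pos, min_le_right _ _, fun _ s hs => hb ?_⟩
      rw [Metric.mem_ball, Subtype.dist_eq, Real.dist_eq]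
      simpa [abs_of_nonneg s.2.1] using hs.trans_le (min_le_left _ _)
    · exact ⟨1, one_pos, le_rfl, fun h' => (h h').elim⟩
  choose ε hε0 hε1 hεO using hε
  let J : V → Set (OneComplex G) := fun w =>
    {p | ∃ (h : G.Adj v w) (s : unitInterval), ε w ≤ s ∧ edgePath G ⟨(v, w), h⟩ s = p}
  let T : Set V → Set (OneComplex G) := fun W => ⋃ w ∈ W, J w
  have hTmono : ∀ {W W'}, W ⊆ W' → T W ⊆ T W' := fun h => biUnion_subset_biUnion_left h
  have hJconn : ∀ w, IsPreconnected (J w) := by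
    intro w
    by_cases h : G.Adj v w
    · have hJ : J w = (fun s : ℝ => edgePath G ⟨(v, w), h⟩ (projIcc 0 1 zero_le_one s)) ''
          Icc (ε w) 1 := by
        ext p
        constructor
        · rintro ⟨_, s, hs, rfl⟩
          exact ⟨s, ⟨hs, s.2.2⟩, by simp only [projIcc_val]⟩
        · rintro ⟨s, hs, rfl⟩
          have h01 : s ∈ Icc (0 : ℝ) 1 := ⟨(hε0 w).le.trans hs.1, hs.2⟩
          exact ⟨h, ⟨s, h01⟩, hs.1, by simp only [projIcc_of_mem _ h01]⟩
      rw [hJ]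
      exact isPreconnected_Icc.image _
        ((continuous_edgePath _).comp continuous_projIcc).continuousOn
    · have hJ : J w = ∅ := eq_empty_of_forall_notMem fun p ⟨h', _⟩ => h h'
      rw [hJ]
      exact isPreconnected_empty
  have hxS : x ∈ closure (stoneCechUnit '' T univ) := by
    rw [mem_closure_iff]
    intro P hP hxP
    obtain ⟨_, ⟨hzP, hzO'⟩, p, ⟨d, rfl, s, rfl⟩, rfl⟩ :=
      mem_closure_iff.1 hxv.1 (P ∩ O') (hP.inter hO') ⟨hxP, hxO'⟩
    refine ⟨_, hzP, mem_image_of_mem _ (mem_biUnion (mem_univ d.snd) ⟨d.adj, s, ?_, rfl⟩)⟩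
    by_contra! hs
    exact disjoint_left.1 hOO' (hεO d.snd d.adj s hs) hzO'
  -- Points on the edges at `v` tend to `x` along an ultrafilter, whose image `𝒲` lives on the
  -- neighbours of `v`.
  have hne : (comap stoneCechUnit (𝓝[stoneCechUnit '' T univ] x) ⊓ 𝓟 (T univ)).NeBot :=
    have := mem_closure_iff_nhdsWithin_neBot.1 hxS
    comap_inf_principal_neBot_of_image_mem this self_mem_nhdsWithin
  obtain ⟨𝒰, h𝒰⟩ := Ultrafilter.exists_le
    (comap stoneCechUnit (𝓝[stoneCechUnit '' T univ] x) ⊓ 𝓟 (T univ))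
  have hS𝒰 : T univ ∈ 𝒰 := h𝒰 (mem_inf_of_right (mem_principal_self _))
  have hx𝒰 : Tendsto stoneCechUnit (𝒰 : Filter (OneComplex G)) (𝓝 x) :=
    (tendsto_comap.mono_left (h𝒰.trans inf_le_left)).mono_right nhdsWithin_le_nhds
  have hr : ∀ p : OneComplex G, ∃ w, p ∈ T univ → p ∈ J w := fun p => by
    by_cases h : p ∈ T univ
    · obtain ⟨w, -, hw⟩ := mem_iUnion₂.1 h
      exact ⟨w, fun _ => hw⟩
    · exact ⟨v, fun h' => (h h').elim⟩
  choose r hr using hr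
  let 𝒲 : Ultrafilter V := 𝒰.map r
  have hxT : ∀ W ∈ 𝒲, x ∈ closure (stoneCechUnit '' T W) := fun W hW => by
    refine mem_closure_of_tendsto hx𝒰 ?_
    filter_upwards [hS𝒰, Ultrafilter.mem_map.1 hW] with p hp hpW
    exact mem_image_of_mem _ (mem_biUnion hpW (hr p hp))
  have hN : {w | G.Adj v w} ∈ 𝒲 := by
    rw [Ultrafilter.mem_map]
    filter_upwards [hS𝒰] with p hp
    exact (hr p hp).1
  have hfree : ∀ u, ({u}ᶜ : Set V) ∈ 𝒲 := fun u => by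
    rw [Ultrafilter.compl_mem_iff_notMem]
    intro hu
    refine hxr (betaClosure_subset_range (isCompact_inducedPts ({v, u} : Finset V))
      (betaClosure_mono ?_ (hxT _ hu)))
    refine iUnion₂_subset fun w hw => ?_
    rintro _ ⟨h, s, -, rfl⟩
    obtain rfl : w = u := hw
    exact edgePath_mem_inducedPts (by simp) (by simp) s
  obtain ⟨y, -, hy⟩ := isCompact_univ.ultrafilter_le_nhds
    (𝒲.map fun w => (stoneCechUnit (vertexPt G w) : Beta G)) (by simp)
  have hyW : ∀ W ∈ 𝒲, y ∈ betaClosure G (vertexPt G '' W) := fun W hW => by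
    refine mem_closure_of_tendsto (f := fun w => (stoneCechUnit (vertexPt G w) : Beta G))
      (b := (𝒲 : Filter V)) hy ?_
    filter_upwards [hW] with w hw
    exact mem_image_of_mem _ (mem_image_of_mem _ hw)
  let K : Set (Beta G) := ⋂ W : {W // W ∈ 𝒲}, closure (stoneCechUnit '' T W)
  have hKW : ∀ W ∈ 𝒲, K ⊆ closure (stoneCechUnit '' T W) := fun W hW =>
    iInter_subset (fun W : {W // W ∈ 𝒲} => closure (stoneCechUnit '' T W)) ⟨W, hW⟩
  refine ⟨K, ?_, ?_, mem_iInter.2 fun W => hxT W W.2, y, mem_iInter.2 fun W => ?_, ?_⟩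
  · rintro _ hz ⟨g, rfl⟩
    by_cases hg : ∃ u, u ≠ v ∧ g.1 u ≠ 0
    · obtain ⟨u, huv, hgu⟩ := hg
      refine stoneCechUnit_notMem_betaClosure hgu (fun q hq => ?_) (hKW _ (hfree u) hz)
      obtain ⟨w, hw, h, s, -, rfl⟩ := mem_iUnion₂.1 hq
      exact edgePath_apply_of_ne (d := ⟨(v, w), h⟩) huv (Ne.symm hw) s
    · -- The remaining case is `g = v`; the function `k` is steep enough to be at least `1` on
      -- all the segments.
      push Not at hg
      let k : V → ℝ := fun u => if u = v then 0 else (ε u)⁻¹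
      have hgk : affineExt k g ≤ 0 := by
        rw [affineExt, Finsupp.linearCombination_apply, Finsupp.sum]
        refine (Finset.sum_eq_zero fun u _ => ?_).le
        by_cases h : u = v
        · simp [k, h]
        · simp [hg u h]
      refine stoneCechUnit_notMem_closure (continuous_affineExt k) one_pos hgk (fun q hq => ?_)
        (hKW _ univ_mem hz)
      obtain ⟨w, -, h, s, hs, rfl⟩ := mem_iUnion₂.1 hq
      rw [affineExt_edgePath]
      simp only [k, if_pos, if_neg h.ne', mul_zero, zero_add]
      rw [← div_eq_mul_inv, one_le_div (hε0 w)]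
      exact hs
  · refine (isPreconnected_iff_subset_of_fully_disjoint_closed
      (isClosed_iInter fun _ => isClosed_closure)).2 fun P Q hP hQ hK hPQ => ?_
    obtain ⟨U₁, U₂, hU₁, hU₂, hPU, hQU, hU⟩ := normal_separation hP hQ hPQ
    have : Nonempty {W // W ∈ 𝒲} := ⟨⟨univ, univ_mem⟩⟩
    obtain ⟨⟨W, hW⟩, hWU⟩ := exists_subset_nhds_of_isCompact
      (V := fun W : {W // W ∈ 𝒲} => closure (stoneCechUnit '' T W : Set (Beta G)))
      (fun W W' => ⟨⟨W ∩ W', inter_mem W.2 W'.2⟩,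
        closure_mono (image_mono (hTmono inter_subset_left)),
        closure_mono (image_mono (hTmono inter_subset_right))⟩)
      (fun _ => isClosed_closure.isCompact)
      (fun z hz => (hU₁.union hU₂).mem_nhds ((hK.trans (union_subset_union hPU hQU)) hz))
    have hJU : ∀ w ∈ W, stoneCechUnit '' J w ⊆ U₁ ∨ stoneCechUnit '' J w ⊆ U₂ := fun w hw =>
      ((hJconn w).image _ continuous_stoneCechUnit.continuousOn).subset_or_subset hU₁ hU₂ hU
        ((image_mono (subset_biUnion_of_mem hw)).trans (subset_closure.trans hWU))
    -- A set of edges in the ultrafilter whose segments all lie in `U` forces `K ⊆ closure U`.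
    have hKU : ∀ U : Set (Beta G), {w | stoneCechUnit '' J w ⊆ U} ∈ 𝒲 → K ⊆ closure U :=
      fun U hUW => (hKW _ hUW).trans (closure_mono (by
        rw [image_iUnion₂]
        exact iUnion₂_subset fun w hw => hw))
    rcases 𝒲.em fun w => stoneCechUnit '' J w ⊆ U₁ with h | h
    · refine Or.inl fun z hz => (hK hz).resolve_right fun hzQ => ?_
      exact disjoint_left.1 (hU.closure_left hU₂) (hKU U₁ h hz) (hQU hzQ)
    · refine Or.inr fun z hz => (hK hz).resolve_left fun hzP => ?_
      have h₂ : {w | stoneCechUnit '' J w ⊆ U₂} ∈ 𝒲 := by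
        filter_upwards [h, hW] with w hw hwW
        exact (hJU w hwW).resolve_left hw
      exact disjoint_left.1 (hU.symm.closure_left hU₁) (hKU U₂ h₂ hz) (hPU hzP)
  · refine betaClosure_mono ?_ (hyW _ (inter_mem W.2 hN))
    rintro _ ⟨w, ⟨hw, h⟩, rfl⟩
    exact mem_biUnion hw ⟨h, 1, hε1 w, edgePath_one _⟩
  · rw [mem_auxRemainder_iff hG]
    refine fun u => betaClosure_mono ?_ (hyW _ (hfree u))
    rintro _ ⟨w, hw, rfl⟩
    exact vertexPt_mem_inducedPts hw

/-! ### Bipartitions of the components of `G - X` -/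

theorem subset_sideVerts (X : Set V) (𝒞 : Set (G.ComponentCompl X)) : X ⊆ sideVerts G X 𝒞 :=
  subset_union_left

theorem mem_inducedPts_sideVerts {X : Set V} {𝒞 : Set (G.ComponentCompl X)} {p : OneComplex G}
    {u : V} (hu : u ∉ X) (hpu : p.1 u ≠ 0) (h : G.componentComplMk hu ∈ 𝒞) :
    p ∈ inducedPts G (sideVerts G X 𝒞) := by
  have hmem : ∀ w ∈ G.componentComplMk hu, w ∈ sideVerts G X 𝒞 := fun w hw =>
    Or.inr (mem_biUnion h hw)
  refine mem_inducedPts_iff.2 fun w hw => ?_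
  by_contra hpw
  have hu' := G.componentComplMk_mem hu
  rcases p.eq_or_adj hpu hpw with rfl | hadj
  · exact hw (hmem _ hu')
  · exact hw (hmem _ (SimpleGraph.ComponentCompl.mem_of_adj u w hu'
      (fun hX => hw (subset_sideVerts X 𝒞 hX)) hadj))

theorem inducedPts_sideVerts_union {X : Set V} {𝒞₁ 𝒞₂ : Set (G.ComponentCompl X)}
    (h : 𝒞₁ ∪ 𝒞₂ = univ) :
    inducedPts G (sideVerts G X 𝒞₁) ∪ inducedPts G (sideVerts G X 𝒞₂) = univ := by
  refine eq_univ_of_forall fun p => ?_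
  by_cases hp : ∃ u ∉ X, p.1 u ≠ 0
  · obtain ⟨u, hu, hpu⟩ := hp
    exact (h.symm ▸ mem_univ (G.componentComplMk hu) : _ ∈ 𝒞₁ ∪ 𝒞₂).imp
      (mem_inducedPts_sideVerts hu hpu) (mem_inducedPts_sideVerts hu hpu)
  · push Not at hp
    exact Or.inl (inducedPts_mono (subset_sideVerts X 𝒞₁) (mem_inducedPts_iff.2 hp))

theorem sideVerts_inter_subset {X : Set V} {𝒞₁ 𝒞₂ : Set (G.ComponentCompl X)}
    (h : Disjoint 𝒞₁ 𝒞₂) : sideVerts G X 𝒞₁ ∩ sideVerts G X 𝒞₂ ⊆ X := by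
  rintro u ⟨hu | hu, hu' | hu'⟩
  · exact hu
  · exact hu
  · exact hu'
  · obtain ⟨C, hC, huC⟩ := mem_iUnion₂.1 hu
    obtain ⟨D, hD, huD⟩ := mem_iUnion₂.1 hu'
    have hne : C ≠ D := fun e => disjoint_left.1 h hC (e ▸ hD)
    exact (disjoint_left.1 (SimpleGraph.ComponentCompl.pairwise_disjoint hne) huC huD).elim

/-- The two sides overlap in the finite graph `G[X]`, so their closures are disjoint on `G^*`. -/
theorem betaClosure_sideVerts_inter_subset {X : Finset V}
    {𝒞₁ 𝒞₂ : Set (G.ComponentCompl (X : Set V))} (h : 𝒞₁ ∪ 𝒞₂ = univ) (hd : Disjoint 𝒞₁ 𝒞₂) :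
    betaClosure G (inducedPts G (sideVerts G X 𝒞₁)) ∩
      betaClosure G (inducedPts G (sideVerts G X 𝒞₂)) ⊆ range stoneCechUnit := by
  refine (closure_stoneCechUnit_inter_subset (isClosed_inducedPts _) (isClosed_inducedPts _)
    (inducedPts_sideVerts_union h)).trans ?_
  rw [inducedPts_inter]
  exact (betaClosure_mono (inducedPts_mono (sideVerts_inter_subset hd))).trans
    (betaClosure_subset_range (isCompact_inducedPts X))

theorem mem_betaClosure_sideVerts {X : Set V} {𝒞₁ 𝒞₂ : Set (G.ComponentCompl X)}
    (h : 𝒞₁ ∪ 𝒞₂ = univ) (z : Beta G) :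
    z ∈ betaClosure G (inducedPts G (sideVerts G X 𝒞₁)) ∨
      z ∈ betaClosure G (inducedPts G (sideVerts G X 𝒞₂)) := by
  have hz : z ∈ betaClosure G univ := betaClosure_univ ▸ mem_univ z
  rwa [← inducedPts_sideVerts_union h, betaClosure_union] at hz

/-- Enlarging `X` refines the components of `G - X` and keeps the two sides. -/
theorem sideVerts_subset_preimage_hom {X Y : Set V} (h : X ⊆ Y) (𝒞 : Set (G.ComponentCompl X)) :
    sideVerts G X 𝒞 ⊆ sideVerts G Y (SimpleGraph.ComponentCompl.hom h ⁻¹' 𝒞) := by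
  rintro u (hu | hu)
  · exact Or.inl (h hu)
  · by_cases huY : u ∈ Y
    · exact Or.inl huY
    · obtain ⟨C, hC, huX, rfl⟩ := mem_iUnion₂.1 hu
      exact Or.inr (mem_biUnion (x := G.componentComplMk huY) hC (G.componentComplMk_mem huY))

/-- A point of the 1-complex is joined to each vertex of its support inside every induced subgraph
which contains it. -/
theorem exists_isPreconnected_vertexPt {p : OneComplex G} {u : V} (hpu : p.1 u ≠ 0) :
    ∃ S : Set (OneComplex G), IsPreconnected S ∧ p ∈ S ∧ vertexPt G u ∈ S ∧
      ∀ W, p ∈ inducedPts G W → S ⊆ inducedPts G W := by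
  by_cases hpv : ∃ v, p = vertexPt G v
  · obtain ⟨v, rfl⟩ := hpv
    obtain rfl : u = v := by
      by_contra h
      exact hpu (vertexPt_apply_of_ne h)
    exact ⟨{vertexPt G u}, isPreconnected_singleton, rfl, rfl, fun W h => singleton_subset_iff.2 h⟩
  · obtain ⟨_, v, w, h, t, rfl⟩ := p
    rcases h with rfl | h
    · exact (hpv ⟨v, Subtype.ext (by simp [vertexPt])⟩).elim
    let d : G.Dart := ⟨(v, w), h⟩
    change ¬∃ x, edgePath G d t = vertexPt G x at hpv
    change (edgePath G d t).1 u ≠ 0 at hpu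
    refine ⟨range (edgePath G d), isPreconnected_range (continuous_edgePath d), ⟨t, rfl⟩, ?_,
      fun W hW => ?_⟩
    · by_cases h₁ : u = d.fst
      · exact ⟨0, by rw [edgePath_zero, h₁]⟩
      · by_cases h₂ : u = d.snd
        · exact ⟨1, by rw [edgePath_one, h₂]⟩
        · exact (hpu (edgePath_apply_of_ne h₁ h₂ t)).elim
    · change edgePath G d t ∈ _ at hW
      rw [mem_inducedPts_iff] at hW
      have h₁ : d.fst ∈ W := by
        by_contra h₁
        have h0 := hW _ h₁
        rw [edgePath_apply_fst] at h0
        have ht : t = 1 := Subtype.ext (sub_eq_zero.1 h0).symm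
        exact hpv ⟨d.snd, by rw [ht, edgePath_one]⟩
      have h₂ : d.snd ∈ W := by
        by_contra h₂
        have h0 := hW _ h₂
        rw [edgePath_apply_snd] at h0
        have ht : t = 0 := Subtype.ext h0
        exact hpv ⟨d.fst, by rw [ht, edgePath_zero]⟩
      rintro _ ⟨s, rfl⟩
      exact edgePath_mem_inducedPts h₁ h₂ s

/-- Disjoint open sets `U` and `W` of `βG` covering `G - X` bipartition the components of `G - X`,
since these are connected. -/
theorem exists_components_of_isOpen {X : Set V} {U W : Set (Beta G)} (hU : IsOpen U)
    (hW : IsOpen W) (hUW : Disjoint U W)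
    (hX : ∀ p ∈ inducedPts G Xᶜ, stoneCechUnit p ∈ U ∪ W) :
    ∃ 𝒞₁ 𝒞₂ : Set (G.ComponentCompl X), 𝒞₁ ∪ 𝒞₂ = univ ∧ Disjoint 𝒞₁ 𝒞₂ ∧
      ∀ p ∈ inducedPts G Xᶜ, stoneCechUnit p ∈ U ∧ p ∈ inducedPts G (sideVerts G X 𝒞₁) ∨
        stoneCechUnit p ∈ W ∧ p ∈ inducedPts G (sideVerts G X 𝒞₂) := by
  have hconn : ∀ S : Set (OneComplex G), IsPreconnected S → S ⊆ inducedPts G Xᶜ → ∀ p ∈ S, ∀ q ∈ S,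
      stoneCechUnit p ∈ U → stoneCechUnit q ∈ U := by
    intro S hS hSX p hp q hq hpU
    refine (hS.image _ continuous_stoneCechUnit.continuousOn).subset_left_of_subset_union hU hW hUW
      ?_ ⟨_, mem_image_of_mem _ hp, hpU⟩ (mem_image_of_mem _ hq)
    rintro _ ⟨r, hr, rfl⟩
    exact hX r (hSX hr)
  have hadj : ∀ v w, v ∉ X → w ∉ X → G.Adj v w →
      stoneCechUnit (vertexPt G v) ∈ U → stoneCechUnit (vertexPt G w) ∈ U := by
    intro v w hv hw h
    let d : G.Dart := ⟨(v, w), h⟩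
    refine hconn (range (edgePath G d)) (isPreconnected_range (continuous_edgePath d)) ?_
      _ ⟨0, edgePath_zero d⟩ _ ⟨1, edgePath_one d⟩
    rintro _ ⟨s, rfl⟩
    exact edgePath_mem_inducedPts (d := d) hv hw s
  let f : G.ComponentCompl X → Prop := SimpleGraph.ComponentCompl.lift
    (fun v _ => stoneCechUnit (vertexPt G v) ∈ U)
    fun v w hv hw h => propext ⟨hadj v w hv hw h, hadj w v hw hv h.symm⟩
  refine ⟨{C | f C}, {C | f C}ᶜ, union_compl_self _, disjoint_compl_right, fun p hp => ?_⟩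
  obtain ⟨u, hpu⟩ := p.exists_apply_ne_zero
  have hu : u ∉ X := fun h => hpu (mem_inducedPts_iff.1 hp u (by simpa using h))
  obtain ⟨S, hS, hpS, huS, hSW⟩ := exists_isPreconnected_vertexPt hpu
  by_cases hpU : stoneCechUnit p ∈ U
  · exact Or.inl ⟨hpU, mem_inducedPts_sideVerts hu hpu (hconn S hS (hSW _ hp) _ hpS _ huS hpU)⟩
  · exact Or.inr ⟨(hX p hp).resolve_left hpU, mem_inducedPts_sideVerts hu hpu
      fun h => hpU (hconn S hS (hSW _ hp) _ huS _ hpS h)⟩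

/-- Separation on `G^×`. An open partition of `G^×` already covers `G - X` for some finite `X`, by
compactness. -/
theorem exists_separation_auxRemainder (hG : ∀ v, ∃ w, G.Adj v w) {A B : Set (Beta G)}
    (hAB : Disjoint A B) (hA : IsClosed A) (hB : IsClosed B)
    (hAt : ∀ x ∈ A, x ∈ auxRemainder G → connectedComponentIn (auxRemainder G) x ⊆ A) :
    ∃ (X : Finset V) (𝒞₁ 𝒞₂ : Set (G.ComponentCompl (X : Set V))),
      𝒞₁ ∪ 𝒞₂ = univ ∧ Disjoint 𝒞₁ 𝒞₂ ∧
      A ∩ auxRemainder G ⊆ betaClosure G (inducedPts G (sideVerts G X 𝒞₁)) ∧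
      B ∩ auxRemainder G ⊆ betaClosure G (inducedPts G (sideVerts G X 𝒞₂)) := by
  obtain ⟨U, W, hU, hW, hUW, hcov, hAU, hBW⟩ :=
    exists_isOpen_separation_of_components (isClosed_auxRemainder hG) hA hB hAB hAt
  obtain ⟨X, hX⟩ := (hU.union hW).isClosed_compl.isCompact.elim_finite_subfamily_closed
    (fun v => betaClosure G (inducedPts G {v}ᶜ)) (fun _ => isClosed_betaClosure _) (by
      rw [← auxRemainder_eq_iInter hG, inter_comm, ← sdiff_eq]
      exact sdiff_eq_empty.2 hcov)
  obtain ⟨𝒞₁, 𝒞₂, hun, hd, h⟩ := exists_components_of_isOpen (X := (X : Set V)) hU hW hUW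
    fun p hp => by
      by_contra hpUW
      have hmem : stoneCechUnit p ∈ (U ∪ W)ᶜ ∩ ⋂ v ∈ X, betaClosure G (inducedPts G {v}ᶜ) := by
        refine ⟨hpUW, mem_iInter₂.2 fun v hv => subset_closure (mem_image_of_mem _ ?_)⟩
        exact inducedPts_mono (compl_subset_compl.2 (by simpa using hv)) hp
      rw [hX] at hmem
      exact hmem
  refine ⟨X, 𝒞₁, 𝒞₂, hun, hd, ?_, ?_⟩
  · rintro z ⟨hzA, hz⟩
    have hsub : inducedPts G (X : Set V)ᶜ ⊆
        inducedPts G (sideVerts G X 𝒞₁) ∪ stoneCechUnit ⁻¹' W := fun p hp =>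
      (h p hp).imp And.right And.left
    have h' := betaClosure_mono hsub (auxRemainder_subset_betaClosure hG X hz)
    rw [betaClosure_union] at h'
    refine h'.resolve_right fun hzW => ?_
    exact disjoint_left.1 (hUW.closure_right hU) (hAU ⟨hzA, hz⟩)
      (closure_mono (image_preimage_subset _ _) hzW)
  · rintro z ⟨hzB, hz⟩
    have hsub : inducedPts G (X : Set V)ᶜ ⊆
        stoneCechUnit ⁻¹' U ∪ inducedPts G (sideVerts G X 𝒞₂) := fun p hp =>
      (h p hp).imp And.left And.right
    have h' := betaClosure_mono hsub (auxRemainder_subset_betaClosure hG X hz)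
    rw [betaClosure_union] at h'
    refine h'.resolve_left fun hzU => ?_
    exact disjoint_left.1 (hUW.closure_left hW)
      (closure_mono (image_preimage_subset _ _) hzU) (hBW ⟨hzB, hz⟩)

/-! ### From the auxiliary remainder to all of `βG` -/

/-- If the part of a tame set in `G^×` lies on one side, then so does its part in `G^*`: each
component of `G^*` lies on one side, and reaches `G^×` if it meets an open star. -/
theorem IsTame.inter_remainder_subset (hG : ∀ v, ∃ w, G.Adj v w) {A : Set (Beta G)}
    (hA : IsTame G A) {X : Finset V} {𝒞₁ 𝒞₂ : Set (G.ComponentCompl (X : Set V))}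
    (h : 𝒞₁ ∪ 𝒞₂ = univ) (hd : Disjoint 𝒞₁ 𝒞₂)
    (hAX : A ∩ auxRemainder G ⊆ betaClosure G (inducedPts G (sideVerts G X 𝒞₁))) :
    A ∩ remainder G ⊆ betaClosure G (inducedPts G (sideVerts G X 𝒞₁)) := by
  rintro x ⟨hxA, hxr⟩
  by_cases hx : x ∈ auxRemainder G
  · exact hAX ⟨hxA, hx⟩
  have hxs : x ∈ betaStars G := not_not.1 hx
  obtain ⟨v, hxv⟩ := mem_iUnion.1 hxs
  obtain ⟨K, hKr, hK, hxK, y, hyK, hy⟩ := exists_isPreconnected_auxRemainder hG hxr hxv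
  have hyA : y ∈ A :=
    hA.component_subset x hxA hxr hxs (hK.subset_connectedComponentIn hxK hKr hyK)
  refine (mem_betaClosure_sideVerts h x).resolve_right fun hx₂ => ?_
  obtain ⟨z, hzK, hz⟩ := isPreconnected_closed_iff.1 hK _ _ (isClosed_betaClosure _)
    (isClosed_betaClosure _) (fun z _ => mem_betaClosure_sideVerts h z)
    ⟨y, hyK, hAX ⟨hyA, hy⟩⟩ ⟨x, hxK, hx₂⟩
  exact hKr hzK (betaClosure_sideVerts_inter_subset h hd hz)

/-- A closed set of `βG` contained in `G` lies in a finite subgraph: otherwise a vertex function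
growing fast enough would have an affine extension unbounded on this set. -/
theorem exists_finset_of_isClosed_subset_range {Z : Set (Beta G)} (hZ : IsClosed Z)
    (hZr : Z ⊆ range stoneCechUnit) :
    ∃ Y : Finset V, Z ⊆ stoneCechUnit '' inducedPts G (Y : Set V) := by
  have hfin : {u | ∃ p : OneComplex G, stoneCechUnit p ∈ Z ∧ p.1 u ≠ 0}.Finite := by
    by_contra hinf
    let e := Set.Infinite.natEmbedding _ hinf
    choose p hpZ hp using fun n => (e n).2
    have he : Function.Injective fun n => (e n : V) :=
      Subtype.val_injective.comp e.injective
    let k : V → ℝ := Function.extend (fun n => (e n : V)) (fun n => n / (p n).1 (e n)) 0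
    have hk : ∀ u, 0 ≤ k u := fun u => by
      by_cases h : ∃ n, (e n : V) = u
      · obtain ⟨n, rfl⟩ := h
        simp only [k]
        rw [he.extend_apply (fun n => (n : ℝ) / (p n).1 (e n)) 0 n]
        exact div_nonneg n.cast_nonneg ((p n).apply_nonneg _)
      · simp only [k]
        rw [Function.extend_apply' _ _ _ h]
        rfl
    obtain ⟨M, hM⟩ := exists_forall_le_of_isClosed_stoneCech (continuous_affineExt k) hZ hZr
    obtain ⟨n, hn⟩ := exists_nat_gt M
    refine hn.not_ge (le_trans ?_ (hM (p n) (hpZ n)))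
    refine le_trans (le_of_eq ?_) (le_affineExt hk (p n) (e n))
    simp only [k]
    rw [he.extend_apply (fun n => (n : ℝ) / (p n).1 (e n)) 0 n, mul_div_cancel₀ _ (hp n)]
  refine ⟨hfin.toFinset, fun z hz => ?_⟩
  obtain ⟨p, rfl⟩ := hZr hz
  refine mem_image_of_mem _ (mem_inducedPts_iff.2 fun u hu => ?_)
  by_contra hpu
  exact hu (hfin.mem_toFinset.2 ⟨p, hz, hpu⟩)

/-- If the part of a closed set in `G^*` lies on one side, then only a finite subgraph's worth of
it is on the other side, and this is absorbed by enlarging `X`. -/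
theorem exists_finset_subset_betaClosure {A : Set (Beta G)} (hA : IsClosed A) {X : Finset V}
    {𝒞₁ 𝒞₂ : Set (G.ComponentCompl (X : Set V))} (h : 𝒞₁ ∪ 𝒞₂ = univ) (hd : Disjoint 𝒞₁ 𝒞₂)
    (hAX : A ∩ remainder G ⊆ betaClosure G (inducedPts G (sideVerts G X 𝒞₁))) :
    ∃ Y : Finset V, ∀ (X' : Finset V) (hX : (X : Set V) ⊆ X'), Y ⊆ X' →
      A ⊆ betaClosure G (inducedPts G
        (sideVerts G X' (SimpleGraph.ComponentCompl.hom hX ⁻¹' 𝒞₁))) := by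
  obtain ⟨Y, hY⟩ := exists_finset_of_isClosed_subset_range
    (hA.inter (isClosed_betaClosure (inducedPts G (sideVerts G X 𝒞₂)))) fun z hz => by
      by_contra hzr
      exact hzr (betaClosure_sideVerts_inter_subset h hd ⟨hAX ⟨hz.1, hzr⟩, hz.2⟩)
  refine ⟨Y, fun X' hX hYX z hz => ?_⟩
  rcases mem_betaClosure_sideVerts h z with hz₁ | hz₂
  · exact betaClosure_mono (inducedPts_mono (sideVerts_subset_preimage_hom hX 𝒞₁)) hz₁
  · refine subset_closure (image_mono (inducedPts_mono ?_) (hY ⟨hz, hz₂⟩))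
    exact (Finset.coe_subset.2 hYX).trans (subset_sideVerts _ _)

end GraphBeta

theorem lemma5p12 {V : Type*} [Infinite V] (G : SimpleGraph V) (hG : G.Connected)
    (A B : Set (GraphBeta.Beta G)) (hAB : Disjoint A B)
    (hA : IsClosed A) (hB : IsClosed B)
    (hAt : GraphBeta.IsTame G A) (hBt : GraphBeta.IsTame G B) :
    ∃ (X : Finset V) (𝒞₁ 𝒞₂ : Set (G.ComponentCompl (X : Set V))),
      𝒞₁ ∪ 𝒞₂ = Set.univ ∧ Disjoint 𝒞₁ 𝒞₂ ∧
      A ⊆ GraphBeta.betaClosure G (GraphBeta.inducedPts G (GraphBeta.sideVerts G X 𝒞₁)) ∧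
      B ⊆ GraphBeta.betaClosure G (GraphBeta.inducedPts G (GraphBeta.sideVerts G X 𝒞₂)) := by
  classical
  have hdeg : ∀ v, ∃ w, G.Adj v w := hG.preconnected.exists_adj_of_nontrivial
  obtain ⟨X, 𝒞₁, 𝒞₂, hun, hd, hA₁, hB₂⟩ :=
    GraphBeta.exists_separation_auxRemainder hdeg hAB hA hB hAt.aux_closed
  obtain ⟨Y, hY⟩ := GraphBeta.exists_finset_subset_betaClosure hA hun hd
    (hAt.inter_remainder_subset hdeg hun hd hA₁)
  rw [union_comm] at hun
  obtain ⟨Z, hZ⟩ := GraphBeta.exists_finset_subset_betaClosure hB hun hd.symm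
    (hBt.inter_remainder_subset hdeg hun hd.symm hB₂)
  have hX : (X : Set V) ⊆ (X ∪ (Y ∪ Z) : Finset V) :=
    Finset.coe_subset.2 Finset.subset_union_left
  refine ⟨X ∪ (Y ∪ Z), SimpleGraph.ComponentCompl.hom hX ⁻¹' 𝒞₁,
    SimpleGraph.ComponentCompl.hom hX ⁻¹' 𝒞₂, ?_, hd.preimage _, hY _ hX ?_, hZ _ hX ?_⟩
  · rw [← preimage_union, union_comm, hun, preimage_univ]
  · exact Finset.subset_union_left.trans Finset.subset_union_right
  · exact Finset.subset_union_right.trans Finset.subset_union_right
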